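/- **Recovery guarantee of PRGD.** Let $A_1,\dots,A_m\in\mathbb{R}^{n_1\times n_2}$, let $\mathcal{A}:\mathbb{R}^{n_1\times n_2}\to\mathbb{R}^m$, $(\mathcal{A}Y)_i=\langle A_i,Y\rangle=\mathrm{trace}(A_i^TY)$, and $\mathcal{A}^*p=\sum_i p_iA_i$. Let $X\in\mathbb{R}^{n_1\times n_2}$ have rank $r\ge 1$, let $\kappa$ be its condition number (its largest singular value divided by its smallest nonzero one), and let $y=\mathcal{A}X$. Suppose that $\mathcal{A}$ satisfies the restricted isometry property of order $3r$ with constant $\delta_{3r}\in(0,1)$, that is, $(1-\delta_{3r})\|Z\|_F^2\le\|\mathcal{A}Z\|_2^2\le(1+\delta_{3r})\|Z\|_F^2$ for all $Z$ with $\mathrm{rank}(Z)\le 3r$, and that $$\delta_{3r}\le\frac{1}{50+100\sqrt r\,\kappa}.$$ For a matrix $Y$ with singular value decomposition $Y=\sum_i\sigma_iu_iv_i^T$, $\sigma_1\ge\sigma_2\ge\dots\ge 0$, let $\mathcal{H}_r(Y)=\sum_{i\le r}\sigma_iu_iv_i^T$ (if this depends on the decomposition, any choice is allowed), and let $\|Z\|_\vee$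 be the largest Euclidean norm of a row or column of $Z$. The preconditioned Riemannian gradient descent (PRGD) iterates are $X_0=\mathcal{H}_r(\mathcal{A}^*y)$ and, for $t=0,1,2,\dots$, with $G_t=\mathcal{A}^*(\mathcal{A}X_t-y)$: if $G_t=0$, the iteration has stopped and $X_{t+1}=X_t$; if $G_t\ne0$, put $$\epsilon_t=\|G_t\|_\vee^2,\quad \nu_t=\epsilon_t^{1/2},\quad \mu_t=(\epsilon_t+\|G_t\|_\vee^2)^{1/2},\quad \alpha_t=\frac{2}{\mu_t^{-1}+\nu_t^{-1}},$$ $$L_t=\epsilon_tI_{n_1}+\mathrm{diag}(G_tG_t^T),\qquad R_t=\epsilon_tI_{n_2}+\mathrm{diag}(G_t^TG_t),$$ $$X_{t+1}=\mathcal{H}_r\Big(X_t-\alpha_t\,\widetilde{\mathcal{P}}_{\mathbb{T}_t}\big(L_t^{-1/4}G_tR_t^{-1/4}\big)\Big),$$ where $\mathrm{diag}(\cdot)$ keeps the diagonal part of a matrix, $\mathbb{T}_t=\{CX_t+X_tB : C\in\mathbb{R}^{n_1\times n_1},\,B\in\mathbb{R}^{n_2\times n_2}\}$ is the tangent space at $X_t$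 of the manifold of matrices of the same rank as $X_t$ (equivalently $\{U_tQ^T+PV_t^T\}$ for a compact singular value decomposition $X_t=U_t\Sigma_tV_t^T$), and $\widetilde{\mathcal{P}}_{\mathbb{T}_t}$ is the projection onto $\mathbb{T}_t$ that is orthogonal for the inner product $\langle Z,Y\rangle_{\mathcal{W}_t}=\langle L_t^{1/4}ZR_t^{1/4},Y\rangle$. Then there is a constant $0<\mu\le 0.995$ such that $$\|X_{t+1}-X\|_F\le\mu\,\|X_t-X\|_F\qquad\text{for all }t=0,1,2,\dots$$ -/

import Mathlib

open Matrix

-- From here on `‖Z‖`, for a real matrix `Z`, is the Frobenius norm.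
attribute [local instance] Matrix.frobeniusNormedAddCommGroup

noncomputable section

namespace PRGD

/-- The sensing operator `𝒜 : ℝ^{n₁×n₂} → ℝ^m`, `(𝒜 Y)ᵢ = ⟨Aᵢ, Y⟩ = trace (Aᵢᵀ Y)`, given by the
measurement matrices `A₁, …, A_m`. -/
def sensing {n₁ n₂ m : ℕ} (A : Fin m → Matrix (Fin n₁) (Fin n₂) ℝ)
    (Y : Matrix (Fin n₁) (Fin n₂) ℝ) : EuclideanSpace ℝ (Fin m) :=
  WithLp.toLp 2 fun i => ((A i)ᵀ * Y).trace

/-- The adjoint `𝒜* p = ∑ᵢ pᵢ Aᵢ` of the sensing operator. -/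
def sensingAdjoint {n₁ n₂ m : ℕ} (A : Fin m → Matrix (Fin n₁) (Fin n₂) ℝ)
    (p : EuclideanSpace ℝ (Fin m)) : Matrix (Fin n₁) (Fin n₂) ℝ :=
  ∑ i, p i • A i

/-- The sensing operator satisfies the restricted isometry property of order `s` with
constant `δ ∈ (0,1)`. -/
def SatisfiesRIP {n₁ n₂ m : ℕ} (A : Fin m → Matrix (Fin n₁) (Fin n₂) ℝ) (s : ℕ) (δ : ℝ) : Prop :=
  0 < δ ∧ δ < 1 ∧ ∀ Z : Matrix (Fin n₁) (Fin n₂) ℝ, Z.rank ≤ s →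
    (1 - δ) * ‖Z‖ ^ 2 ≤ ‖sensing A Z‖ ^ 2 ∧ ‖sensing A Z‖ ^ 2 ≤ (1 + δ) * ‖Z‖ ^ 2

/-- The condition number of a matrix: the ratio of its largest singular value to its smallest
nonzero singular value. (Mathlib numbers the singular values from `0` in decreasing order, so the
nonzero ones are those numbered `0, …, rank Z - 1`.) -/
def condNumber {n₁ n₂ : ℕ} (Z : Matrix (Fin n₁) (Fin n₂) ℝ) : ℝ :=
  (Matrix.toEuclideanLin Z).singularValues 0 /
    (Matrix.toEuclideanLin Z).singularValues (Z.rank - 1)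

/-- `‖Z‖_∨`: the largest Euclidean norm among all rows and columns of `Z`. -/
def veeNorm {n₁ n₂ : ℕ} (Z : Matrix (Fin n₁) (Fin n₂) ℝ) : ℝ :=
  max (⨆ i : Fin n₁, ‖(WithLp.toLp 2 (fun j => Z i j) : EuclideanSpace ℝ (Fin n₂))‖)
    (⨆ j : Fin n₂, ‖(WithLp.toLp 2 (fun i => Z i j) : EuclideanSpace ℝ (Fin n₁))‖)

/-- `Y = U diag(σ) Vᵀ = ∑ᵢ σᵢ uᵢ vᵢᵀ` is a singular value decomposition: the columns of `U` and of
`V` are orthonormal and `σ₁ ≥ σ₂ ≥ … ≥ 0`. -/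
structure IsSVD {n₁ n₂ k : ℕ} (Y : Matrix (Fin n₁) (Fin n₂) ℝ) (U : Matrix (Fin n₁) (Fin k) ℝ)
    (σ : Fin k → ℝ) (V : Matrix (Fin n₂) (Fin k) ℝ) : Prop where
  orthoU : Uᵀ * U = 1
  orthoV : Vᵀ * V = 1
  nonneg : ∀ i, 0 ≤ σ i
  antitone : Antitone σ
  eq : Y = U * diagonal σ * Vᵀ

/-- `Z` is a value of the truncated SVD operator `ℋ_r` at `Y`: `Z = ∑_{i ≤ r} σᵢ uᵢ vᵢᵀ` for some
singular value decomposition `Y = ∑ᵢ σᵢ uᵢ vᵢᵀ`. (If `σ_r = σ_{r+1} > 0` there are several such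
`Z`; every one is allowed.) -/
def IsTruncatedSVD {n₁ n₂ : ℕ} (r : ℕ) (Y Z : Matrix (Fin n₁) (Fin n₂) ℝ) : Prop :=
  ∃ (k : ℕ) (U : Matrix (Fin n₁) (Fin k) ℝ) (σ : Fin k → ℝ) (V : Matrix (Fin n₂) (Fin k) ℝ),
    IsSVD Y U σ V ∧ Z = U * diagonal (fun i : Fin k => if (i : ℕ) < r then σ i else 0) * Vᵀ

/-- The tangent space at `X` of the manifold of matrices having the same rank as `X`, written as
`{C X + X B}`. The theorem below identifies it with `{U Qᵀ + P Vᵀ}` for every compact singular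
value decomposition `X = U Σ Vᵀ`. -/
def tangentSpace {n₁ n₂ : ℕ} (X : Matrix (Fin n₁) (Fin n₂) ℝ) :
    Submodule ℝ (Matrix (Fin n₁) (Fin n₂) ℝ) where
  carrier := {Z | ∃ (C : Matrix (Fin n₁) (Fin n₁) ℝ) (B : Matrix (Fin n₂) (Fin n₂) ℝ),
    Z = C * X + X * B}
  zero_mem' := ⟨0, 0, by simp⟩
  add_mem' := by
    rintro _ _ ⟨C, B, rfl⟩ ⟨C', B', rfl⟩
    exact ⟨C + C', B + B', by rw [Matrix.add_mul, Matrix.mul_add]; abel⟩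
  smul_mem' := by
    rintro c _ ⟨C, B, rfl⟩
    exact ⟨c • C, c • B, by rw [smul_add, Matrix.smul_mul, Matrix.mul_smul]⟩

theorem mem_tangentSpace_iff_of_compactSVD {n₁ n₂ k : ℕ} {X : Matrix (Fin n₁) (Fin n₂) ℝ}
    {U : Matrix (Fin n₁) (Fin k) ℝ} {σ : Fin k → ℝ} {V : Matrix (Fin n₂) (Fin k) ℝ}
    (h : IsSVD X U σ V) (hσ : ∀ i, 0 < σ i) (Z : Matrix (Fin n₁) (Fin n₂) ℝ) :
    Z ∈ tangentSpace X ↔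
      ∃ (P : Matrix (Fin n₁) (Fin k) ℝ) (Q : Matrix (Fin n₂) (Fin k) ℝ),
        Z = U * Qᵀ + P * Vᵀ := by
  have hinv : diagonal σ * diagonal (fun i => (σ i)⁻¹) = (1 : Matrix (Fin k) (Fin k) ℝ) := by
    rw [diagonal_mul_diagonal, ← diagonal_one]
    congr 1
    funext i
    exact mul_inv_cancel₀ (hσ i).ne'
  have hinv' : diagonal (fun i => (σ i)⁻¹) * diagonal σ = (1 : Matrix (Fin k) (Fin k) ℝ) := by
    rw [diagonal_mul_diagonal, ← diagonal_one]
    congr 1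
    funext i
    exact inv_mul_cancel₀ (hσ i).ne'
  have hU : X * (V * diagonal (fun i => (σ i)⁻¹)) = U := by
    rw [h.eq, ← Matrix.mul_assoc, Matrix.mul_assoc (U * diagonal σ), h.orthoV, Matrix.mul_one,
      Matrix.mul_assoc, hinv, Matrix.mul_one]
  have hV : (diagonal (fun i => (σ i)⁻¹) * Uᵀ) * X = Vᵀ := by
    rw [h.eq, Matrix.mul_assoc U, Matrix.mul_assoc, ← Matrix.mul_assoc Uᵀ, h.orthoU,
      Matrix.one_mul, ← Matrix.mul_assoc, hinv', Matrix.one_mul]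
  constructor
  · rintro ⟨C, B, rfl⟩
    refine ⟨C * U * diagonal σ, (diagonal σ * Vᵀ * B)ᵀ, ?_⟩
    rw [transpose_transpose, h.eq]
    simp only [Matrix.mul_assoc]
    abel
  · rintro ⟨P, Q, rfl⟩
    refine ⟨P * (diagonal (fun i => (σ i)⁻¹) * Uᵀ), V * diagonal (fun i => (σ i)⁻¹) * Qᵀ, ?_⟩
    rw [Matrix.mul_assoc P, hV, ← Matrix.mul_assoc X, hU, add_comm]

/-- The gradient `𝒜*(𝒜 Z - y)` of `F(Z) = ½‖𝒜 Z - y‖₂²`. -/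
def gradient {n₁ n₂ m : ℕ} (A : Fin m → Matrix (Fin n₁) (Fin n₂) ℝ)
    (y : EuclideanSpace ℝ (Fin m)) (Z : Matrix (Fin n₁) (Fin n₂) ℝ) :
    Matrix (Fin n₁) (Fin n₂) ℝ :=
  sensingAdjoint A (sensing A Z - y)

/-- The diagonal matrix `L = ε I + diag(G Gᵀ)`. -/
def leftPrecond {n₁ n₂ : ℕ} (ε : ℝ) (G : Matrix (Fin n₁) (Fin n₂) ℝ) :
    Matrix (Fin n₁) (Fin n₁) ℝ :=
  ε • (1 : Matrix (Fin n₁) (Fin n₁) ℝ) + diagonal (G * Gᵀ).diag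

/-- The diagonal matrix `R = ε I + diag(Gᵀ G)`. -/
def rightPrecond {n₁ n₂ : ℕ} (ε : ℝ) (G : Matrix (Fin n₁) (Fin n₂) ℝ) :
    Matrix (Fin n₂) (Fin n₂) ℝ :=
  ε • (1 : Matrix (Fin n₂) (Fin n₂) ℝ) + diagonal (Gᵀ * G).diag

/-- The real power `Dˢ` of a diagonal matrix `D` with positive diagonal entries. -/
def diagPow {n : ℕ} (D : Matrix (Fin n) (Fin n) ℝ) (s : ℝ) : Matrix (Fin n) (Fin n) ℝ :=
  diagonal fun i => D i i ^ s

/-- The weighting `Z ↦ Lˢ Z Rˢ`; `s = 1/4` gives the operator `𝒲` and `s = -1/4` its inverse. -/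
def weighting {n₁ n₂ : ℕ} (ε : ℝ) (G : Matrix (Fin n₁) (Fin n₂) ℝ) (s : ℝ)
    (Z : Matrix (Fin n₁) (Fin n₂) ℝ) : Matrix (Fin n₁) (Fin n₂) ℝ :=
  diagPow (leftPrecond ε G) s * Z * diagPow (rightPrecond ε G) s

/-- The weighted inner product `⟨Z, Y⟩_𝒲 = ⟨L^{1/4} Z R^{1/4}, Y⟩`. -/
def weightedInner {n₁ n₂ : ℕ} (ε : ℝ) (G Z Y : Matrix (Fin n₁) (Fin n₂) ℝ) : ℝ :=
  ((weighting ε G (1 / 4) Z)ᵀ * Y).trace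

/-- `D` is the orthogonal projection of `Y` onto the subspace `T` with respect to
`⟨·, ·⟩_𝒲`. -/
def IsWeightedProj {n₁ n₂ : ℕ} (ε : ℝ) (G : Matrix (Fin n₁) (Fin n₂) ℝ)
    (T : Submodule ℝ (Matrix (Fin n₁) (Fin n₂) ℝ)) (Y D : Matrix (Fin n₁) (Fin n₂) ℝ) : Prop :=
  D ∈ T ∧ ∀ Z ∈ T, weightedInner ε G (Y - D) Z = 0

/-- One iteration of PRGD with parameters `ε`, `α`, from `Z` to `Z'`. With `G` the gradient at `Z`:
if `G = 0` the iteration has stopped, and `Z' = Z`; otherwise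
`Z' = ℋ_r (Z - α 𝒫 (L^{-1/4} G R^{-1/4}))`, where `𝒫` is the projection onto the tangent space at
`Z` that is orthogonal for `⟨·, ·⟩_𝒲`. -/
def IsPRGDStep {n₁ n₂ m : ℕ} (A : Fin m → Matrix (Fin n₁) (Fin n₂) ℝ)
    (y : EuclideanSpace ℝ (Fin m)) (r : ℕ) (ε α : ℝ) (Z Z' : Matrix (Fin n₁) (Fin n₂) ℝ) : Prop :=
  (gradient A y Z = 0 → Z' = Z) ∧
  (gradient A y Z ≠ 0 → ∃ D : Matrix (Fin n₁) (Fin n₂) ℝ,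
    IsWeightedProj ε (gradient A y Z) (tangentSpace Z)
      (weighting ε (gradient A y Z) (-(1 / 4)) (gradient A y Z)) D ∧
    IsTruncatedSVD r (Z - α • D) Z')

/-- `Xs` is a sequence of PRGD iterates for the data `y` with parameters `ε_t`, `α_t` and the
initial guess `X₀ = ℋ_r(𝒜* y)`. -/
def IsPRGDSequence {n₁ n₂ m : ℕ} (A : Fin m → Matrix (Fin n₁) (Fin n₂) ℝ)
    (y : EuclideanSpace ℝ (Fin m)) (r : ℕ) (ε α : ℕ → ℝ)
    (Xs : ℕ → Matrix (Fin n₁) (Fin n₂) ℝ) : Prop :=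
  IsTruncatedSVD r (sensingAdjoint A y) (Xs 0) ∧
    ∀ t, IsPRGDStep A y r (ε t) (α t) (Xs t) (Xs (t + 1))

/-- `ν = ε^{1/2}`. -/
def nuConst (ε : ℝ) : ℝ := Real.sqrt ε

/-- `μ = (ε + ‖G‖_∨²)^{1/2}`. -/
def muConst {n₁ n₂ : ℕ} (ε : ℝ) (G : Matrix (Fin n₁) (Fin n₂) ℝ) : ℝ :=
  Real.sqrt (ε + veeNorm G ^ 2)

end PRGD

end

/-! Write `e = Z - X` for the error of an iterate `Z`, and `σ_r` for the least nonzero singular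
value of `X`. The proof shows that the ball `‖e‖ ≤ σ_r / 50` contains the initial guess and that one
step from inside it contracts the error by `16/25`, so the iteration never leaves it.

The start (`norm_initial_sub_le_singularValue`): best approximation and RIP give `‖X₀ - X‖ ≤ 2δ‖X‖`,
while `‖X‖ ≤ √r σ₁ = √r κ σ_r`; the bound on `δ` is exactly what turns this into `σ_r / 50`.

The step rests on three approximations. Inside the ball the error is tangent at `Z` up to `‖e‖ /
50`, because its normal part is quadratic in `e` (`exists_tangent_approx`). Against tangent vectors
the gradient acts like `e` itself up to `δ` (`SatisfiesRIP.abs_inner_sub_frob_le`). Finally, the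
update `a = αD` solves `⟨w ∘ a, Y⟩ = ⟨G, Y⟩` for tangent `Y`, with entrywise weights `w` in `[0.85,
1.21]` (`IsWeightedProj.exists_weights`). Coercivity of the weighted form then yields `‖e - a‖ ≤
(8/25)‖e‖` (`norm_sub_step_le`), and by Eckart–Young the truncation costs at most a factor `2`. -/

namespace PRGD

/-- The Frobenius inner product `⟨Z, Y⟩ = trace (Zᵀ Y)`. -/
def frob {a b : ℕ} (Z Y : Matrix (Fin a) (Fin b) ℝ) : ℝ := (Zᵀ * Y).trace

/-! ### Frobenius inner product and orthogonal projections. -/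

section Frobenius

variable {a b : ℕ}

theorem frob_eq_sum (Z Y : Matrix (Fin a) (Fin b) ℝ) : frob Z Y = ∑ i, ∑ j, Z i j * Y i j := by
  simp only [frob, Matrix.trace, Matrix.diag_apply, Matrix.mul_apply, Matrix.transpose_apply]
  exact Finset.sum_comm

theorem frob_self (Z : Matrix (Fin a) (Fin b) ℝ) : frob Z Z = ‖Z‖ ^ 2 := by
  have h : 0 ≤ ∑ i, ∑ j, Z i j * Z i j :=
    Finset.sum_nonneg fun i _ => Finset.sum_nonneg fun j _ => mul_self_nonneg _
  rw [frob_eq_sum, Matrix.frobenius_norm_def, ← Real.sqrt_eq_rpow, Real.sq_sqrt]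
  · simp [sq]
  · simpa [sq] using h

theorem frob_comm (Z Y : Matrix (Fin a) (Fin b) ℝ) : frob Z Y = frob Y Z := by
  simp only [frob_eq_sum, mul_comm]

theorem frob_add_left (Z Z' Y : Matrix (Fin a) (Fin b) ℝ) :
    frob (Z + Z') Y = frob Z Y + frob Z' Y := by
  simp [frob, Matrix.add_mul]

theorem frob_sub_left (Z Z' Y : Matrix (Fin a) (Fin b) ℝ) :
    frob (Z - Z') Y = frob Z Y - frob Z' Y := by
  simp [frob, Matrix.sub_mul]

theorem frob_smul_left (t : ℝ) (Z Y : Matrix (Fin a) (Fin b) ℝ) :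
    frob (t • Z) Y = t * frob Z Y := by
  simp [frob]

theorem frob_add_right (Z Y Y' : Matrix (Fin a) (Fin b) ℝ) :
    frob Z (Y + Y') = frob Z Y + frob Z Y' := by
  simp [frob, Matrix.mul_add]

theorem frob_sub_right (Z Y Y' : Matrix (Fin a) (Fin b) ℝ) :
    frob Z (Y - Y') = frob Z Y - frob Z Y' := by
  simp [frob, Matrix.mul_sub]

theorem frob_smul_right (t : ℝ) (Z Y : Matrix (Fin a) (Fin b) ℝ) :
    frob Z (t • Y) = t * frob Z Y := by
  simp [frob]

theorem abs_frob_le (Z Y : Matrix (Fin a) (Fin b) ℝ) : |frob Z Y| ≤ ‖Z‖ * ‖Y‖ := by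
  have h : frob Z Y ^ 2 ≤ (‖Z‖ * ‖Y‖) ^ 2 := by
    rw [mul_pow, ← frob_self, ← frob_self]
    simp only [frob_eq_sum, ← Finset.sum_product', Finset.univ_product_univ, ← sq]
    exact Finset.sum_mul_sq_le_sq_mul_sq _ _ _
  exact abs_le_of_sq_le_sq h (by positivity)

theorem norm_sub_sq (Z Y : Matrix (Fin a) (Fin b) ℝ) :
    ‖Z - Y‖ ^ 2 = ‖Z‖ ^ 2 - 2 * frob Z Y + ‖Y‖ ^ 2 := by
  rw [← frob_self, frob_sub_left, frob_sub_right, frob_sub_right, frob_self, frob_self,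
    frob_comm Y Z]
  ring

/-- A symmetric idempotent splits the Frobenius norm orthogonally. -/
theorem norm_sq_split {P : Matrix (Fin a) (Fin a) ℝ} (hP : Pᵀ = P) (hPP : P * P = P)
    (Z : Matrix (Fin a) (Fin b) ℝ) : ‖Z‖ ^ 2 = ‖P * Z‖ ^ 2 + ‖Z - P * Z‖ ^ 2 := by
  have h : frob Z (P * Z) = ‖P * Z‖ ^ 2 := by
    rw [← frob_self, frob, frob, Matrix.transpose_mul, hP, Matrix.mul_assoc Zᵀ, ← Matrix.mul_assoc P,
      hPP]
  rw [norm_sub_sq, h]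
  ring

theorem norm_proj_mul_le {P : Matrix (Fin a) (Fin a) ℝ} (hP : Pᵀ = P) (hPP : P * P = P)
    (Z : Matrix (Fin a) (Fin b) ℝ) : ‖P * Z‖ ≤ ‖Z‖ :=
  le_of_sq_le_sq (by nlinarith [norm_sq_split hP hPP Z, sq_nonneg ‖Z - P * Z‖]) (norm_nonneg _)

theorem norm_sub_proj_mul_le {P : Matrix (Fin a) (Fin a) ℝ} (hP : Pᵀ = P) (hPP : P * P = P)
    (Z : Matrix (Fin a) (Fin b) ℝ) : ‖Z - P * Z‖ ≤ ‖Z‖ :=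
  le_of_sq_le_sq (by nlinarith [norm_sq_split hP hPP Z, sq_nonneg ‖P * Z‖]) (norm_nonneg _)

theorem norm_sub_mul_proj_le {P : Matrix (Fin b) (Fin b) ℝ} (hP : Pᵀ = P) (hPP : P * P = P)
    (Z : Matrix (Fin a) (Fin b) ℝ) : ‖Z - Z * P‖ ≤ ‖Z‖ := by
  have h := norm_sub_proj_mul_le hP hPP Zᵀ
  rwa [← Matrix.frobenius_norm_transpose (Z - Z * P), Matrix.transpose_sub, Matrix.transpose_mul, hP,
    ← Matrix.frobenius_norm_transpose Z]

theorem norm_sq_eq_trace (Z : Matrix (Fin a) (Fin b) ℝ) : ‖Z‖ ^ 2 = (Zᵀ * Z).trace :=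
  (frob_self Z).symm

theorem norm_sq_eq_trace' (Z : Matrix (Fin a) (Fin b) ℝ) : ‖Z‖ ^ 2 = (Z * Zᵀ).trace := by
  rw [norm_sq_eq_trace, Matrix.trace_mul_comm]

end Frobenius

/-! ### Gram matrix, singular values and the Moore–Penrose inverse. -/

section PseudoInverse

variable {a b : ℕ}

/-- Links the singular values of the operator, which define the condition number, to the matrix
spectral theorem for `Mᵀ * M`. -/
theorem sq_singularValues_eq_eigenvalues₀ (M : Matrix (Fin a) (Fin b) ℝ)
    (h : (Mᵀ * M).IsHermitian) (i : Fin (Fintype.card (Fin b))) :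
    (Matrix.toEuclideanLin M).singularValues i ^ 2 = h.eigenvalues₀ i := by
  have hT : LinearMap.adjoint (Matrix.toEuclideanLin M) ∘ₗ Matrix.toEuclideanLin M
      = Matrix.toEuclideanLin (Mᵀ * M) := by
    rw [← Matrix.toEuclideanLin_conjTranspose_eq_adjoint,
      Matrix.conjTranspose_eq_transpose_of_trivial]
    ext x : 1
    simp only [LinearMap.comp_apply, Matrix.toLpLin_apply, Matrix.mulVec_mulVec]
  have hn : Module.finrank ℝ (EuclideanSpace ℝ (Fin b)) = Fintype.card (Fin b) :=
    finrank_euclideanSpace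
  have congr : ∀ {S T : EuclideanSpace ℝ (Fin b) →ₗ[ℝ] EuclideanSpace ℝ (Fin b)}
      (hS : S.IsSymmetric) (hT : T.IsSymmetric), S = T →
      hS.eigenvalues hn i = hT.eigenvalues hn i := by
    rintro S T hS hT rfl
    rfl
  exact (LinearMap.sq_singularValues_fin _ hn i).trans (congr _ _ hT)

/-- Spectral decomposition of the Gram matrix, in terms of the singular values. -/
theorem exists_gram_spectral (M : Matrix (Fin a) (Fin b) ℝ) :
    ∃ (V : Matrix (Fin b) (Fin b) ℝ) (l : Fin b → ℝ), Vᵀ * V = 1 ∧ V * Vᵀ = 1 ∧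
      Mᵀ * M = V * diagonal l * Vᵀ ∧ Fintype.card {i // l i ≠ 0} = M.rank ∧
      (∀ i, l i ≤ (Matrix.toEuclideanLin M).singularValues 0 ^ 2) ∧
      ∀ i, l i ≠ 0 → (Matrix.toEuclideanLin M).singularValues (M.rank - 1) ^ 2 ≤ l i := by
  have h : (Mᵀ * M).IsHermitian := by
    simpa [Matrix.conjTranspose_eq_transpose_of_trivial] using
      Matrix.isHermitian_conjTranspose_mul_self M
  set s := (Matrix.toEuclideanLin M).singularValues with hs
  have hl : ∀ i, ∃ k : ℕ, h.eigenvalues i = s k ^ 2 := fun i =>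
    ⟨_, (sq_singularValues_eq_eigenvalues₀ M h _).symm⟩
  have hrank : Module.finrank ℝ (Matrix.toEuclideanLin M).range = M.rank := by
    rw [Matrix.rank_eq_finrank_range_toLin M (EuclideanSpace.basisFun (Fin a) ℝ).toBasis
      (EuclideanSpace.basisFun (Fin b) ℝ).toBasis, Matrix.toEuclideanLin_eq_toLin_orthonormal]
  refine ⟨h.eigenvectorUnitary, h.eigenvalues, ?_, ?_, ?_, ?_, ?_, ?_⟩
  · have := Unitary.coe_star_mul_self h.eigenvectorUnitary
    rwa [Matrix.star_eq_conjTranspose, Matrix.conjTranspose_eq_transpose_of_trivial] at this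
  · have := Unitary.coe_mul_star_self h.eigenvectorUnitary
    rwa [Unitary.coe_star, Matrix.star_eq_conjTranspose, Matrix.conjTranspose_eq_transpose_of_trivial] at this
  · conv_lhs => rw [h.spectral_theorem, Unitary.conjStarAlgAut_apply]
    rw [Matrix.star_eq_conjTranspose, Matrix.conjTranspose_eq_transpose_of_trivial]
    rfl
  · rw [← h.rank_eq_card_non_zero_eigs, Matrix.rank_transpose_mul_self]
  · intro i
    obtain ⟨k, hk⟩ := hl i
    rw [hk]
    exact pow_le_pow_left₀ (LinearMap.singularValues_nonneg _ _)
      (LinearMap.singularValues_antitone _ (Nat.zero_le k)) 2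
  · intro i hi
    obtain ⟨k, hk⟩ := hl i
    rw [hk] at hi ⊢
    have hk' : k < M.rank := by
      rw [← hrank, ← LinearMap.singularValues_pos_iff_lt_finrank_range,
        LinearMap.singularValues_pos_iff_ne_zero]
      exact fun h0 => hi (by simp [hs, h0])
    exact pow_le_pow_left₀ (LinearMap.singularValues_nonneg _ _)
      (LinearMap.singularValues_antitone _ (by omega)) 2

theorem norm_sq_le_rank_mul (M : Matrix (Fin a) (Fin b) ℝ) :
    ‖M‖ ^ 2 ≤ M.rank * (Matrix.toEuclideanLin M).singularValues 0 ^ 2 := by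
  obtain ⟨V, l, hV, -, hM, hr, hl, -⟩ := exists_gram_spectral M
  rw [norm_sq_eq_trace, hM, Matrix.trace_mul_comm, ← Matrix.mul_assoc, hV, Matrix.one_mul,
    Matrix.trace_diagonal, ← Finset.sum_filter_ne_zero, ← hr, Fintype.card_subtype, ← nsmul_eq_mul]
  exact Finset.sum_le_card_nsmul _ _ _ fun i _ => hl i

/-- The Moore–Penrose inverse, with the norm bound given by the least nonzero singular value. -/
theorem exists_pseudoInverse (M : Matrix (Fin a) (Fin b) ℝ) :
    ∃ K : Matrix (Fin b) (Fin a) ℝ, M * K * M = M ∧ (M * K)ᵀ = M * K ∧ (K * M)ᵀ = K * M ∧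
      (M * K).trace = M.rank ∧ ∀ {c : ℕ} (E : Matrix (Fin c) (Fin b) ℝ),
        (Matrix.toEuclideanLin M).singularValues (M.rank - 1) * ‖E * K‖ ≤ ‖E‖ := by
  obtain ⟨V, l, hV, hV', hM, hr, -, hl⟩ := exists_gram_spectral M
  have conj : ∀ f g : Fin b → ℝ, V * diagonal f * Vᵀ * (V * diagonal g * Vᵀ)
      = V * diagonal (fun i => f i * g i) * Vᵀ := by
    intro f g
    rw [Matrix.mul_assoc (V * diagonal f), ← Matrix.mul_assoc Vᵀ, ← Matrix.mul_assoc Vᵀ, hV,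
      Matrix.one_mul, ← Matrix.mul_assoc, Matrix.mul_assoc V, diagonal_mul_diagonal]
  have conjT : ∀ f : Fin b → ℝ, (V * diagonal f * Vᵀ)ᵀ = V * diagonal f * Vᵀ := by
    intro f
    simp [Matrix.mul_assoc]
  -- Since `0⁻¹ = 0`, `W` is the pseudoinverse of the Gram matrix, and `W * Mᵀ` that of `M`.
  set W := V * diagonal (fun i => (l i)⁻¹) * Vᵀ with hW
  have hWT : Wᵀ = W := conjT _
  have hWS : W * (Mᵀ * M) = V * diagonal (fun i => (l i)⁻¹ * l i) * Vᵀ := by rw [hM, conj]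
  have hSWS : (Mᵀ * M) * (W * (Mᵀ * M)) = Mᵀ * M := by
    rw [hWS, hM, conj]
    congr 3
    funext i
    by_cases h : l i = 0 <;> simp [h]
  have hWSW : W * (Mᵀ * M) * W = W := by
    rw [hWS, hW, conj]
    congr 3
    funext i
    by_cases h : l i = 0 <;> simp [h]
  refine ⟨W * Mᵀ, ?_, ?_, ?_, ?_, ?_⟩
  -- The defect `MKM - M` is killed by `Mᵀ` and also factors through `M` on the left, so it is
  -- orthogonal to itself.
  · rw [← sub_eq_zero, ← Matrix.conjTranspose_mul_self_eq_zero,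
      Matrix.conjTranspose_eq_transpose_of_trivial]
    have h1 : Mᵀ * (M * (W * Mᵀ) * M - M) = 0 := by
      rw [Matrix.mul_sub, sub_eq_zero]
      simpa only [Matrix.mul_assoc] using hSWS
    have h2 : M * (W * Mᵀ) * M - M = M * (W * (Mᵀ * M) - 1) := by
      simp only [Matrix.mul_sub, Matrix.mul_assoc, Matrix.mul_one]
    nth_rewrite 1 [h2]
    rw [Matrix.transpose_mul, Matrix.mul_assoc, h1, Matrix.mul_zero]
  · simp [hWT, Matrix.mul_assoc]
  · rw [Matrix.mul_assoc, hWS, conjT]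
  · rw [Matrix.trace_mul_comm, Matrix.mul_assoc, hWS, Matrix.trace_mul_comm, ← Matrix.mul_assoc, hV,
      Matrix.one_mul, Matrix.trace_diagonal, ← hr, Fintype.card_subtype, Finset.card_filter]
    push_cast
    refine Finset.sum_congr rfl fun i _ => ?_
    by_cases h : l i = 0 <;> simp [h]
  · intro c E
    set s := (Matrix.toEuclideanLin M).singularValues (M.rank - 1)
    refine le_of_sq_le_sq ?_ (norm_nonneg _)
    -- As `K * Kᵀ = W`, the squared norm of `E * K` is the trace of `E W Eᵀ`, diagonal in the
    -- eigenbasis `V`.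
    have e1 : ‖E * (W * Mᵀ)‖ ^ 2 = ∑ i, (l i)⁻¹ * ∑ j, (E * V) j i ^ 2 := by
      rw [norm_sq_eq_trace']
      have : E * (W * Mᵀ) * (E * (W * Mᵀ))ᵀ
          = (E * V) * (diagonal (fun i => (l i)⁻¹) * (E * V)ᵀ) := by
        simp only [Matrix.transpose_mul, Matrix.transpose_transpose, hWT]
        calc E * (W * Mᵀ) * (M * W * Eᵀ) = E * (W * (Mᵀ * M) * W) * Eᵀ := by
              simp only [Matrix.mul_assoc]
          _ = _ := by rw [hWSW, hW]; simp only [Matrix.mul_assoc]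
      rw [this, Matrix.trace_mul_comm, Matrix.trace]
      refine Finset.sum_congr rfl fun i _ => ?_
      rw [Matrix.diag_apply, Matrix.mul_assoc, Matrix.diagonal_mul, Matrix.mul_apply]
      simp [sq]
    have e2 : ‖E‖ ^ 2 = ∑ i, ∑ j, (E * V) j i ^ 2 := by
      have : E * Eᵀ = (E * V) * (E * V)ᵀ := by
        rw [Matrix.transpose_mul, Matrix.mul_assoc, ← Matrix.mul_assoc V, hV', Matrix.one_mul]
      rw [norm_sq_eq_trace', this, Matrix.trace_mul_comm, ← frob, frob_eq_sum, Finset.sum_comm]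
      simp [sq]
    rw [mul_pow, e1, e2, Finset.mul_sum]
    refine Finset.sum_le_sum fun i _ => ?_
    rw [← mul_assoc]
    refine mul_le_of_le_one_left (Finset.sum_nonneg fun j _ => sq_nonneg _) ?_
    by_cases h : l i = 0
    · simp [h]
    · have h1 := hl i h
      have h0 : 0 < l i := lt_of_le_of_ne ((sq_nonneg _).trans h1) (Ne.symm h)
      rw [← div_eq_mul_inv]
      exact div_le_one_of_le₀ h1 h0.le

end PseudoInverse

/-! ### Truncated SVD and the Eckart–Young theorem. -/

section BestApproximation

variable {a b : ℕ}

theorem norm_sq_mul_diagonal_mul {k : ℕ} {U : Matrix (Fin a) (Fin k) ℝ}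
    {V : Matrix (Fin b) (Fin k) ℝ} (hU : Uᵀ * U = 1) (hV : Vᵀ * V = 1) (c : Fin k → ℝ) :
    ‖U * diagonal c * Vᵀ‖ ^ 2 = ∑ i, c i ^ 2 := by
  have : (U * diagonal c * Vᵀ)ᵀ * (U * diagonal c * Vᵀ)
      = V * (diagonal c * (Uᵀ * U) * diagonal c * Vᵀ) := by
    simp [Matrix.mul_assoc]
  rw [norm_sq_eq_trace, this, hU, Matrix.mul_one, diagonal_mul_diagonal, Matrix.trace_mul_comm,
    Matrix.mul_assoc, hV, Matrix.mul_one, Matrix.trace_diagonal]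
  simp [sq]

theorem IsTruncatedSVD.rank_le {r : ℕ} {Y Z : Matrix (Fin a) (Fin b) ℝ}
    (h : IsTruncatedSVD r Y Z) : Z.rank ≤ r := by
  obtain ⟨k, U, σ, V, -, rfl⟩ := h
  refine (Matrix.rank_mul_le_left _ _).trans ((Matrix.rank_mul_le_right _ _).trans ?_)
  rw [Matrix.rank_diagonal, Fintype.card_subtype]
  calc _ ≤ (Finset.univ.filter fun i : Fin k => (i : ℕ) < r).card := by
        refine Finset.card_le_card fun i hi => ?_
        simp only [Finset.mem_filter, Finset.mem_univ, true_and] at hi ⊢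
        by_contra h
        simp [h] at hi
    _ ≤ (Finset.range r).card :=
        Finset.card_le_card_of_injOn (fun i => (i : ℕ)) (fun i hi => by simpa using hi)
          fun i _ j _ h => Fin.ext h
    _ = r := Finset.card_range r

/-- A decreasing sequence, averaged with weights in `[0, 1]` of total mass at most `r`, has at most
the sum of its first `r` terms. -/
theorem sum_mul_le_sum_initial {k r : ℕ} {q h : Fin k → ℝ} (hq : Antitone q) (hq0 : ∀ i, 0 ≤ q i)
    (h0 : ∀ i, 0 ≤ h i) (h1 : ∀ i, h i ≤ 1) (hsum : ∑ i, h i ≤ r) :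
    ∑ i, q i * h i ≤ ∑ i : Fin k, if (i : ℕ) < r then q i else 0 := by
  by_cases hk : r < k
  · set c := q ⟨r, hk⟩
    -- With `c` the first discarded value, `q i - c` and `h i - 1_{i < r}` never have the same
    -- strict sign. After summation, `c ≥ 0` and the mass bound finish.
    have key : ∀ i : Fin k, q i * h i - (if (i : ℕ) < r then q i else 0)
        ≤ c * (h i - if (i : ℕ) < r then 1 else 0) := by
      intro i
      split_ifs with hi
      · have : c ≤ q i := hq (Fin.mk_le_mk.2 hi.le : i ≤ ⟨r, hk⟩)
        nlinarith [h1 i]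
      · have : q i ≤ c := hq (show (⟨r, hk⟩ : Fin k) ≤ i from not_lt.1 hi)
        nlinarith [h0 i]
    have hcount : ∑ i : Fin k, (if (i : ℕ) < r then (1 : ℝ) else 0) = r := by
      rw [Fin.sum_univ_eq_sum_range (fun i => if i < r then (1 : ℝ) else 0), ← Finset.sum_filter]
      have : (Finset.range k).filter (· < r) = Finset.range r := by
        ext i
        simp only [Finset.mem_filter, Finset.mem_range]
        omega
      simp [this]
    have := Finset.sum_le_sum fun i (_ : i ∈ Finset.univ) => key i
    rw [Finset.sum_sub_distrib, ← Finset.mul_sum, Finset.sum_sub_distrib, hcount] at this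
    nlinarith [hq0 ⟨r, hk⟩]
  · refine Finset.sum_le_sum fun i _ => ?_
    rw [if_pos (by omega)]
    exact mul_le_of_le_one_right (hq0 i) (h1 i)

/-- Eckart–Young: a truncated singular value decomposition is a best approximation of rank at most
`r` in the Frobenius norm. -/
theorem IsTruncatedSVD.norm_sub_le {r : ℕ} {Y Z : Matrix (Fin a) (Fin b) ℝ}
    (h : IsTruncatedSVD r Y Z) {M : Matrix (Fin a) (Fin b) ℝ} (hM : M.rank ≤ r) :
    ‖Y - Z‖ ≤ ‖Y - M‖ := by
  obtain ⟨k, U, σ, V, ⟨hU, hV, hσ, hanti, hY⟩, rfl⟩ := h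
  obtain ⟨K, hMKM, hPT, -, htr, -⟩ := exists_pseudoInverse M
  set P := M * K with hP
  have hPP : P * P = P := by
    rw [hP, ← Matrix.mul_assoc, hMKM]
  clear_value P
  have hdiff : Y - U * diagonal (fun i : Fin k => if (i : ℕ) < r then σ i else 0) * Vᵀ
      = U * diagonal (fun i : Fin k => if (i : ℕ) < r then 0 else σ i) * Vᵀ := by
    rw [hY, ← Matrix.sub_mul, ← Matrix.mul_sub, diagonal_sub]
    congr 3
    funext i
    split_ifs <;> simp
  have hQT : (U * Uᵀ)ᵀ = U * Uᵀ := by simp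
  have hQQ : U * Uᵀ * (U * Uᵀ) = U * Uᵀ := by
    rw [Matrix.mul_assoc, ← Matrix.mul_assoc Uᵀ, hU, Matrix.one_mul]
  have hPU : (P * U)ᵀ * (P * U) = Uᵀ * P * U := by
    rw [Matrix.transpose_mul, hPT, Matrix.mul_assoc, ← Matrix.mul_assoc P P, hPP, Matrix.mul_assoc]
  -- With `P` the projection onto the column space of `M`, the entries `(UᵀPU)ᵢᵢ = ‖P uᵢ‖²` lie in
  -- `[0, 1]`, have sum at most `tr P = rank M ≤ r`, and are the weights in `‖PY‖² = ∑ σᵢ² ‖P uᵢ‖²`.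
  -- Hence `PY` captures at most the top `r` squared singular values.
  have h0 : ∀ i, 0 ≤ (Uᵀ * P * U) i i := by
    intro i
    rw [← hPU, Matrix.mul_apply]
    exact Finset.sum_nonneg fun j _ => mul_self_nonneg _
  have h1 : ∀ i, (Uᵀ * P * U) i i ≤ 1 := by
    intro i
    have e : (U - P * U)ᵀ * (U - P * U) = 1 - Uᵀ * P * U := by
      rw [Matrix.transpose_sub, Matrix.sub_mul, Matrix.mul_sub, Matrix.mul_sub, hPU, hU,
        Matrix.transpose_mul, hPT, Matrix.mul_assoc Uᵀ]
      abel
    have : 0 ≤ ((U - P * U)ᵀ * (U - P * U)) i i := by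
      rw [Matrix.mul_apply]
      exact Finset.sum_nonneg fun j _ => mul_self_nonneg _
    rw [e, Matrix.sub_apply, Matrix.one_apply_eq] at this
    linarith
  have hsum : ∑ i, (Uᵀ * P * U) i i ≤ r := by
    have e1 : ∑ i, (Uᵀ * P * U) i i = ‖U * Uᵀ * P‖ ^ 2 := by
      change (Uᵀ * P * U).trace = _
      have : (U * Uᵀ * P)ᵀ * (U * Uᵀ * P) = P * (U * Uᵀ * P) := by
        rw [Matrix.transpose_mul, hPT, hQT, Matrix.mul_assoc, ← Matrix.mul_assoc (U * Uᵀ), hQQ]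
      rw [norm_sq_eq_trace, this, Matrix.trace_mul_comm P, Matrix.mul_assoc (U * Uᵀ) P, hPP,
        Matrix.mul_assoc U, Matrix.trace_mul_comm U]
    have e2 : ‖P‖ ^ 2 = M.rank := by rw [norm_sq_eq_trace, hPT, hPP, htr]
    have e3 := norm_proj_mul_le hQT hQQ P
    have e4 : (M.rank : ℝ) ≤ r := by exact_mod_cast hM
    rw [e1]
    exact (pow_le_pow_left₀ (norm_nonneg _) e3 2).trans (e2.le.trans e4)
  have hPY : ‖P * Y‖ ^ 2 = ∑ i, σ i ^ 2 * (Uᵀ * P * U) i i := by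
    have : (P * Y)ᵀ * (P * Y) = V * (diagonal σ * (Uᵀ * P * U) * diagonal σ * Vᵀ) := by
      rw [← hPU, hY]
      simp [Matrix.mul_assoc]
    rw [norm_sq_eq_trace, this, Matrix.trace_mul_comm, Matrix.mul_assoc, hV, Matrix.mul_one,
      Matrix.trace]
    refine Finset.sum_congr rfl fun i _ => ?_
    rw [Matrix.diag_apply, Matrix.mul_diagonal, Matrix.diagonal_mul]
    ring
  have hq : Antitone fun i => σ i ^ 2 := fun i j hij => pow_le_pow_left₀ (hσ j) (hanti hij) 2
  have hle := sum_mul_le_sum_initial hq (fun i => sq_nonneg _) h0 h1 hsum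
  have hPM : P * M = M := hMKM
  have hlow : ‖Y - P * Y‖ ≤ ‖Y - M‖ := by
    have := norm_sub_proj_mul_le hPT hPP (Y - M)
    rwa [Matrix.mul_sub, hPM, sub_sub_sub_cancel_right] at this
  refine le_trans (le_of_sq_le_sq ?_ (norm_nonneg _)) hlow
  have hsplit := norm_sq_split hPT hPP Y
  have hYn : ‖Y‖ ^ 2 = ∑ i, σ i ^ 2 := by rw [hY, norm_sq_mul_diagonal_mul hU hV]
  rw [hdiff, norm_sq_mul_diagonal_mul hU hV]
  have hs : ∑ i : Fin k, (if (i : ℕ) < r then 0 else σ i) ^ 2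
      = ∑ i, σ i ^ 2 - ∑ i : Fin k, (if (i : ℕ) < r then σ i ^ 2 else 0) := by
    rw [← Finset.sum_sub_distrib]
    refine Finset.sum_congr rfl fun i _ => ?_
    split_ifs <;> simp
  linarith

end BestApproximation

/-! ### Consequences of RIP, rank bounds and the initial guess. -/

section Sensing

variable {n₁ n₂ m : ℕ} (A : Fin m → Matrix (Fin n₁) (Fin n₂) ℝ)

theorem sensing_add (Z Y : Matrix (Fin n₁) (Fin n₂) ℝ) :
    sensing A (Z + Y) = sensing A Z + sensing A Y := by
  ext i
  simp [sensing, Matrix.mul_add]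

theorem sensing_sub (Z Y : Matrix (Fin n₁) (Fin n₂) ℝ) :
    sensing A (Z - Y) = sensing A Z - sensing A Y := by
  ext i
  simp [sensing, Matrix.mul_sub]

theorem sensing_smul (t : ℝ) (Z : Matrix (Fin n₁) (Fin n₂) ℝ) :
    sensing A (t • Z) = t • sensing A Z := by
  ext i
  simp [sensing]

theorem frob_sensingAdjoint (p : EuclideanSpace ℝ (Fin m)) (Z : Matrix (Fin n₁) (Fin n₂) ℝ) :
    frob (sensingAdjoint A p) Z = inner ℝ p (sensing A Z) := by
  simp [frob, sensingAdjoint, sensing, Matrix.transpose_sum, Matrix.sum_mul, Matrix.trace_sum,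
    PiLp.inner_apply, mul_comm]

theorem gradient_sensing (X Z : Matrix (Fin n₁) (Fin n₂) ℝ) :
    gradient A (sensing A X) Z = sensingAdjoint A (sensing A (Z - X)) := by
  rw [gradient, sensing_sub]

variable {A}

/-- The restricted isometry property in bilinear form. -/
theorem SatisfiesRIP.abs_inner_sub_frob_le {s : ℕ} {δ : ℝ} (h : SatisfiesRIP A s δ)
    {Z Y : Matrix (Fin n₁) (Fin n₂) ℝ} (hZY : ∀ a b : ℝ, (a • Z + b • Y).rank ≤ s) :
    |inner ℝ (sensing A Z) (sensing A Y) - frob Z Y| ≤ δ * (‖Z‖ * ‖Y‖) := by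
  set β := inner ℝ (sensing A Z) (sensing A Y) - frob Z Y with hβ
  have hquad : ∀ a b : ℝ, 4 * (a * b * β) ≤ 2 * δ * (a ^ 2 * ‖Z‖ ^ 2 + b ^ 2 * ‖Y‖ ^ 2) := by
    intro a b
    have hp := (h.2.2 _ (hZY a b)).2
    have hm := (h.2.2 _ (hZY a (-b))).1
    have expand : ∀ c : ℝ, ‖sensing A (a • Z + c • Y)‖ ^ 2 = a ^ 2 * ‖sensing A Z‖ ^ 2
        + 2 * (a * c * inner ℝ (sensing A Z) (sensing A Y)) + c ^ 2 * ‖sensing A Y‖ ^ 2 := by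
      intro c
      rw [sensing_add, sensing_smul, sensing_smul, norm_add_sq_real, norm_smul, norm_smul,
        inner_smul_left, inner_smul_right, mul_pow, mul_pow, Real.norm_eq_abs, Real.norm_eq_abs,
        sq_abs, sq_abs]
      simp only [conj_trivial]
      ring
    have expand' : ∀ c : ℝ, ‖a • Z + c • Y‖ ^ 2 = a ^ 2 * ‖Z‖ ^ 2
        + 2 * (a * c * frob Z Y) + c ^ 2 * ‖Y‖ ^ 2 := by
      intro c
      rw [← frob_self, frob_add_left, frob_add_right, frob_add_right, frob_smul_left,
        frob_smul_left, frob_smul_right, frob_smul_right, frob_smul_left, frob_smul_right,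
        frob_smul_left, frob_smul_right, frob_self, frob_self, frob_comm Y Z]
      ring
    rw [expand, expand'] at hp hm
    rw [hβ]
    linarith
  have hZ0 : 0 ≤ ‖Z‖ := norm_nonneg Z
  have hY0 : 0 ≤ ‖Y‖ := norm_nonneg Y
  rcases hZ0.eq_or_lt with hZ | hZ
  · have h0 : Z = 0 := norm_eq_zero.1 hZ.symm
    have : β = 0 := by simp [hβ, h0, sensing, frob, PiLp.inner_apply]
    simp [this, ← hZ]
  rcases hY0.eq_or_lt with hY | hY
  · have h0 : Y = 0 := norm_eq_zero.1 hY.symm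
    have : β = 0 := by simp [hβ, h0, sensing, frob, PiLp.inner_apply]
    simp [this, ← hY]
  have hpos : 0 < ‖Z‖ * ‖Y‖ := mul_pos hZ hY
  -- These coefficients give both terms on the right of `hquad` the same size `‖Z‖²‖Y‖²`; the two
  -- signs give the two sides of the absolute value.
  have h1 := hquad ‖Y‖ ‖Z‖
  have h2 := hquad ‖Y‖ (-‖Z‖)
  rw [abs_le]
  constructor <;> refine le_of_mul_le_mul_left ?_ hpos <;> linarith

theorem rank_smul_le {a b : ℕ} (t : ℝ) (Z : Matrix (Fin a) (Fin b) ℝ) : (t • Z).rank ≤ Z.rank := by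
  have : t • Z = (t • (1 : Matrix (Fin a) (Fin a) ℝ)) * Z := by simp
  rw [this]
  exact Matrix.rank_mul_le_right _ _

theorem rank_add_le {a b : ℕ} (Z Y : Matrix (Fin a) (Fin b) ℝ) :
    (Z + Y).rank ≤ Z.rank + Y.rank := by
  unfold Matrix.rank
  rw [Matrix.mulVecLin_add]
  exact (Submodule.finrank_mono (LinearMap.range_add_le _ _)).trans
    (Submodule.finrank_add_le_finrank_add_finrank _ _)

theorem rank_sub_le {a b : ℕ} (Z Y : Matrix (Fin a) (Fin b) ℝ) :
    (Z - Y).rank ≤ Z.rank + Y.rank := by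
  have h := rank_add_le Z ((-1 : ℝ) • Y)
  have h' := rank_smul_le (-1) Y
  rw [neg_one_smul, ← sub_eq_add_neg] at h
  rw [neg_one_smul] at h'
  omega

theorem rank_le_of_mem_tangentSpace {X Z : Matrix (Fin n₁) (Fin n₂) ℝ}
    (h : Z ∈ tangentSpace X) : Z.rank ≤ 2 * X.rank := by
  obtain ⟨C, B, rfl⟩ := h
  have h1 := rank_add_le (C * X) (X * B)
  have h2 := Matrix.rank_mul_le_right C X
  have h3 := Matrix.rank_mul_le_left X B
  omega

theorem self_mem_tangentSpace (X : Matrix (Fin n₁) (Fin n₂) ℝ) : X ∈ tangentSpace X :=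
  ⟨1, 0, by simp⟩

/-- The error `Z - X` and a tangent vector at `Z` span matrices of rank at most `3 r`. -/
theorem rank_tangent_combination_le {r : ℕ} {X Z Y : Matrix (Fin n₁) (Fin n₂) ℝ}
    (hX : X.rank ≤ r) (hZ : Z.rank ≤ r) (hY : Y ∈ tangentSpace Z) (a b : ℝ) :
    (a • (Z - X) + b • Y).rank ≤ 3 * r := by
  have e : a • (Z - X) + b • Y = (a • Z + b • Y) - a • X := by
    rw [smul_sub]
    abel
  -- `Z` is itself tangent at `Z`, so it adds no rank: the count is `2r + r`, not `4r`.
  have hT : a • Z + b • Y ∈ tangentSpace Z :=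
    add_mem (Submodule.smul_mem _ _ (self_mem_tangentSpace Z)) (Submodule.smul_mem _ _ hY)
  have h1 := rank_sub_le (a • Z + b • Y) (a • X)
  have h2 := rank_le_of_mem_tangentSpace hT
  have h3 := rank_smul_le a X
  rw [e]
  omega

/-- Expanding the best-approximation inequality `‖Y - X₀‖ ≤ ‖Y - X‖` for `Y = 𝒜*𝒜X` gives `‖X₀ - X‖²
≤ 2⟨Y - X, X₀ - X⟩`, and bilinear RIP bounds the right side by `2δ‖X‖‖X₀ - X‖`. -/
theorem norm_initial_sub_le {r : ℕ} {δ : ℝ} (h : SatisfiesRIP A (3 * r) δ)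
    {X X₀ : Matrix (Fin n₁) (Fin n₂) ℝ} (hX : X.rank ≤ r)
    (h₀ : IsTruncatedSVD r (sensingAdjoint A (sensing A X)) X₀) : ‖X₀ - X‖ ≤ 2 * δ * ‖X‖ := by
  set Y := sensingAdjoint A (sensing A X) with hY
  have hr := h₀.rank_le
  have hbest := h₀.norm_sub_le hX
  have hsq : ‖(Y - X) - (X₀ - X)‖ ^ 2 ≤ ‖Y - X‖ ^ 2 := by
    rw [sub_sub_sub_cancel_right]
    exact pow_le_pow_left₀ (norm_nonneg _) hbest 2
  rw [norm_sub_sq] at hsq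
  have hrank : ∀ a b : ℝ, (a • X + b • (X₀ - X)).rank ≤ 3 * r := by
    intro a b
    have e : a • X + b • (X₀ - X) = (a - b) • X + b • X₀ := by
      rw [smul_sub, sub_smul]
      abel
    have h1 := rank_add_le ((a - b) • X) (b • X₀)
    have h2 := rank_smul_le (a - b) X
    have h3 := rank_smul_le b X₀
    rw [e]
    omega
  have hb := (abs_le.1 (h.abs_inner_sub_frob_le hrank)).2
  rw [← frob_sensingAdjoint, ← hY, ← frob_sub_left] at hb
  rcases (norm_nonneg (X₀ - X)).eq_or_lt with h0 | h0
  · rw [← h0]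
    exact mul_nonneg (mul_nonneg two_pos.le h.1.le) (norm_nonneg _)
  · refine le_of_mul_le_mul_right ?_ h0
    nlinarith

theorem singularValues_mul_condNumber (X : Matrix (Fin n₁) (Fin n₂) ℝ) :
    (Matrix.toEuclideanLin X).singularValues (X.rank - 1) * condNumber X
      = (Matrix.toEuclideanLin X).singularValues 0 := by
  unfold condNumber
  -- The quotient degenerates only for rank `0`, where `X.rank - 1` truncates to `0` and every
  -- singular value vanishes.
  by_cases h : (Matrix.toEuclideanLin X).singularValues (X.rank - 1) = 0
  · have : X.rank = Module.finrank ℝ (Matrix.toEuclideanLin X).range := by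
      rw [Matrix.rank_eq_finrank_range_toLin X (EuclideanSpace.basisFun (Fin n₁) ℝ).toBasis
        (EuclideanSpace.basisFun (Fin n₂) ℝ).toBasis, Matrix.toEuclideanLin_eq_toLin_orthonormal]
    rw [LinearMap.singularValues_eq_zero_iff_le_finrank_range, ← this] at h
    have h0 : (Matrix.toEuclideanLin X).singularValues 0 = 0 := by
      rw [LinearMap.singularValues_eq_zero_iff_le_finrank_range, ← this]
      omega
    simp [h0]
  · field_simp

theorem condNumber_nonneg (X : Matrix (Fin n₁) (Fin n₂) ℝ) : 0 ≤ condNumber X :=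
  div_nonneg (LinearMap.singularValues_nonneg _ _) (LinearMap.singularValues_nonneg _ _)

theorem norm_initial_sub_le_singularValue {r : ℕ} {δ : ℝ} (h : SatisfiesRIP A (3 * r) δ)
    {X X₀ : Matrix (Fin n₁) (Fin n₂) ℝ} (hX : X.rank = r)
    (hδ : δ ≤ 1 / (50 + 100 * Real.sqrt (r : ℝ) * condNumber X))
    (h₀ : IsTruncatedSVD r (sensingAdjoint A (sensing A X)) X₀) :
    ‖X₀ - X‖ ≤ (Matrix.toEuclideanLin X).singularValues (X.rank - 1) / 50 := by
  have h1 := norm_initial_sub_le h hX.le h₀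
  have hκ := condNumber_nonneg X
  have hs : 0 ≤ (Matrix.toEuclideanLin X).singularValues (X.rank - 1) :=
    LinearMap.singularValues_nonneg _ _
  have hX2 : ‖X‖ ≤ Real.sqrt r * (Matrix.toEuclideanLin X).singularValues 0 := by
    refine le_of_sq_le_sq ?_ (mul_nonneg (Real.sqrt_nonneg _) (LinearMap.singularValues_nonneg _ _))
    rw [mul_pow, Real.sq_sqrt (Nat.cast_nonneg r), ← hX]
    exact norm_sq_le_rank_mul X
  rw [← singularValues_mul_condNumber] at hX2
  set s := (Matrix.toEuclideanLin X).singularValues (X.rank - 1)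
  set κ := condNumber X
  have hr := Real.sqrt_nonneg (r : ℝ)
  rw [le_div_iff₀ (by positivity)] at hδ
  have hδ0 := h.1
  have h2 : 2 * δ * ‖X‖ ≤ 2 * δ * (Real.sqrt r * (s * κ)) :=
    mul_le_mul_of_nonneg_left hX2 (by positivity)
  have h3 : 100 * (δ * (Real.sqrt r * κ)) * s ≤ 1 * s :=
    mul_le_mul_of_nonneg_right (by linarith) hs
  linarith

theorem delta_le_of_condNumber {r : ℕ} {δ : ℝ} {X : Matrix (Fin n₁) (Fin n₂) ℝ}
    (hδ : δ ≤ 1 / (50 + 100 * Real.sqrt (r : ℝ) * condNumber X)) : δ ≤ 1 / 50 := by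
  have hκ := condNumber_nonneg X
  refine hδ.trans (one_div_le_one_div_of_le (by norm_num) ?_)
  have : 0 ≤ 100 * Real.sqrt (r : ℝ) * condNumber X := by positivity
  linarith

end Sensing

/-! ### The error is tangent up to second order. -/

section Tangent

variable {n₁ n₂ : ℕ}

/-- Close to `X`, the error `Z - X` is nearly tangent at `Z`. -/
theorem exists_tangent_approx {X Z : Matrix (Fin n₁) (Fin n₂) ℝ}
    (h : ‖Z - X‖ ≤ (Matrix.toEuclideanLin X).singularValues (X.rank - 1) / 50) :
    ∃ p ∈ tangentSpace Z, ‖(Z - X) - p‖ ≤ ‖Z - X‖ / 50 := by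
  obtain ⟨K, hK, -, -, -, hKb⟩ := exists_pseudoInverse X
  obtain ⟨L, hL, hLl, hLr, -, -⟩ := exists_pseudoInverse Z
  have hll : Z * L * (Z * L) = Z * L := by rw [← Matrix.mul_assoc, hL]
  have hrr : L * Z * (L * Z) = L * Z := by
    rw [Matrix.mul_assoc L, ← Matrix.mul_assoc Z, hL]
  set e := Z - X with he
  have heK : ‖e * K‖ ≤ 1 / 50 := by
    have h1 := hKb e
    set s := (Matrix.toEuclideanLin X).singularValues (X.rank - 1)
    have hs : 0 ≤ s := LinearMap.singularValues_nonneg _ _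
    rcases hs.eq_or_lt with hs | hs
    · have : e = 0 := by
        rw [← norm_le_zero_iff]
        simpa [← hs] using h
      simp [this]
    · refine le_of_mul_le_mul_left ?_ hs
      linarith
  have hn : ‖e * K * e‖ ≤ ‖e‖ / 50 := by
    refine (Matrix.frobenius_norm_mul _ _).trans ?_
    have := mul_le_mul_of_nonneg_right heK (norm_nonneg e)
    linarith
  -- Let `P = ZL` and `Q = LZ` be the projections attached to `Z`. Since `(1-P)Z = 0 = Z(1-Q)` and
  -- `X = XKX`, one has `(1-P)X(1-Q) = (1-P)eKe(1-Q)`. Up to sign this is the normal part of `e`, so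
  -- adding it to `e` leaves a tangent matrix.
  set N := e * K * e - Z * L * (e * K * e) with hN
  have hl : e - Z * L * e = -(X - Z * L * X) := by
    rw [he, Matrix.mul_sub, hL]
    abel
  have hr : e - e * (L * Z) = -(X - X * (L * Z)) := by
    rw [he, Matrix.sub_mul, ← Matrix.mul_assoc Z, hL]
    abel
  have hNr : N - N * (L * Z) = (X - Z * L * X) - (X - Z * L * X) * (L * Z) := by
    calc N - N * (L * Z) = (e - Z * L * e) * K * (e - e * (L * Z)) := by
          rw [hN]
          simp only [Matrix.sub_mul, Matrix.mul_sub, Matrix.mul_assoc]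
      _ = (X - Z * L * X) * K * (X - X * (L * Z)) := by
          rw [hl, hr, Matrix.neg_mul, Matrix.neg_mul, Matrix.mul_neg, neg_neg]
      _ = (X * K * X - Z * L * (X * K * X))
            - (X * K * X - Z * L * (X * K * X)) * (L * Z) := by
          simp only [Matrix.sub_mul, Matrix.mul_sub, Matrix.mul_assoc]
      _ = _ := by rw [hK]
  refine ⟨e + (N - N * (L * Z)), ⟨Z * L * X * L - X * L, 1 - L * X, ?_⟩, ?_⟩
  · rw [hNr, he]
    simp only [Matrix.sub_mul, Matrix.mul_sub, Matrix.mul_assoc, Matrix.mul_one]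
    abel
  · rw [sub_add_cancel_left, norm_neg]
    exact (norm_sub_mul_proj_le hLr hrr N).trans ((norm_sub_proj_mul_le hLl hll _).trans hn)

end Tangent

/-! ### The diagonal weights and the preconditioned tangent step. -/

section Preconditioning

variable {n₁ n₂ : ℕ}

theorem norm_row_le_veeNorm (G : Matrix (Fin n₁) (Fin n₂) ℝ) (i : Fin n₁) :
    ‖(WithLp.toLp 2 (fun j => G i j) : EuclideanSpace ℝ (Fin n₂))‖ ≤ veeNorm G :=
  (le_ciSup (f := fun i => ‖(WithLp.toLp 2 (fun j => G i j) : EuclideanSpace ℝ (Fin n₂))‖)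
    (Set.finite_range _).bddAbove i).trans (le_max_left _ _)

theorem norm_col_le_veeNorm (G : Matrix (Fin n₁) (Fin n₂) ℝ) (j : Fin n₂) :
    ‖(WithLp.toLp 2 (fun i => G i j) : EuclideanSpace ℝ (Fin n₁))‖ ≤ veeNorm G :=
  (le_ciSup (f := fun j => ‖(WithLp.toLp 2 (fun i => G i j) : EuclideanSpace ℝ (Fin n₁))‖)
    (Set.finite_range _).bddAbove j).trans (le_max_right _ _)

theorem veeNorm_pos {G : Matrix (Fin n₁) (Fin n₂) ℝ} (hG : G ≠ 0) : 0 < veeNorm G := by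
  obtain ⟨i, j, hij⟩ : ∃ i j, G i j ≠ 0 := by
    by_contra! h
    exact hG (Matrix.ext h)
  refine lt_of_lt_of_le ?_ (norm_row_le_veeNorm G i)
  rw [norm_pos_iff]
  intro h
  exact hij (congrArg (fun v : EuclideanSpace ℝ (Fin n₂) => v j) h)

/-- Diagonal entries of `G * Gᵀ` are squared row norms of `G`, hence at most `veeNorm G ^ 2`. -/
theorem leftPrecond_apply_mem (ε : ℝ) (G : Matrix (Fin n₁) (Fin n₂) ℝ) (i : Fin n₁) :
    ε ≤ leftPrecond ε G i i ∧ leftPrecond ε G i i ≤ ε + veeNorm G ^ 2 := by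
  have e : leftPrecond ε G i i
      = ε + ‖(WithLp.toLp 2 (fun j => G i j) : EuclideanSpace ℝ (Fin n₂))‖ ^ 2 := by
    rw [EuclideanSpace.norm_sq_eq]
    simp [leftPrecond, Matrix.mul_apply, sq]
  rw [e]
  exact ⟨by linarith [sq_nonneg ‖(WithLp.toLp 2 (fun j => G i j) : EuclideanSpace ℝ (Fin n₂))‖],
    by linarith [pow_le_pow_left₀ (norm_nonneg _) (norm_row_le_veeNorm G i) 2]⟩

theorem rightPrecond_apply_mem (ε : ℝ) (G : Matrix (Fin n₁) (Fin n₂) ℝ) (j : Fin n₂) :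
    ε ≤ rightPrecond ε G j j ∧ rightPrecond ε G j j ≤ ε + veeNorm G ^ 2 := by
  have e : rightPrecond ε G j j
      = ε + ‖(WithLp.toLp 2 (fun i => G i j) : EuclideanSpace ℝ (Fin n₁))‖ ^ 2 := by
    rw [EuclideanSpace.norm_sq_eq]
    simp [rightPrecond, Matrix.mul_apply, sq]
  rw [e]
  exact ⟨by linarith [sq_nonneg ‖(WithLp.toLp 2 (fun i => G i j) : EuclideanSpace ℝ (Fin n₁))‖],
    by linarith [pow_le_pow_left₀ (norm_nonneg _) (norm_col_le_veeNorm G j) 2]⟩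

theorem weighting_apply (ε s : ℝ) (G Z : Matrix (Fin n₁) (Fin n₂) ℝ) (i : Fin n₁) (j : Fin n₂) :
    weighting ε G s Z i j = leftPrecond ε G i i ^ s * rightPrecond ε G j j ^ s * Z i j := by
  simp only [weighting, diagPow, Matrix.mul_diagonal, Matrix.diagonal_mul]
  ring

theorem rpow_quarter_mul_self {x : ℝ} (hx : 0 ≤ x) :
    x ^ (1 / 4 : ℝ) * x ^ (1 / 4 : ℝ) = Real.sqrt x := by
  rw [← Real.rpow_add_of_nonneg hx (by norm_num) (by norm_num), Real.sqrt_eq_rpow]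
  norm_num

/-- The entrywise weights of `𝒲` lie between `ν` and `μ`. -/
theorem weight_mem {ε : ℝ} (hε : 0 ≤ ε) (G : Matrix (Fin n₁) (Fin n₂) ℝ) (i : Fin n₁)
    (j : Fin n₂) :
    nuConst ε ≤ leftPrecond ε G i i ^ (1 / 4 : ℝ) * rightPrecond ε G j j ^ (1 / 4 : ℝ) ∧
      leftPrecond ε G i i ^ (1 / 4 : ℝ) * rightPrecond ε G j j ^ (1 / 4 : ℝ) ≤ muConst ε G := by
  obtain ⟨hl, hl'⟩ := leftPrecond_apply_mem ε G i
  obtain ⟨hr, hr'⟩ := rightPrecond_apply_mem ε G j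
  have hl0 := hε.trans hl
  have hr0 := hε.trans hr
  rw [nuConst, muConst, ← rpow_quarter_mul_self hε,
    ← rpow_quarter_mul_self (hl0.trans hl')]
  constructor <;> gcongr

/-- With `ε = ‖G‖_∨²`, the weights of `𝒲` divided by the step size are close to `1`. -/
theorem weight_div_stepSize_mem {G : Matrix (Fin n₁) (Fin n₂) ℝ} (hG : G ≠ 0) {ε α : ℝ}
    (hε : ε = veeNorm G ^ 2) (hα : α = 2 / ((muConst ε G)⁻¹ + (nuConst ε)⁻¹)) :
    0 < α ∧ ∀ i j, 17 / 20 * α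
        ≤ leftPrecond ε G i i ^ (1 / 4 : ℝ) * rightPrecond ε G j j ^ (1 / 4 : ℝ) ∧
      leftPrecond ε G i i ^ (1 / 4 : ℝ) * rightPrecond ε G j j ^ (1 / 4 : ℝ)
        ≤ 121 / 100 * α := by
  have hg := veeNorm_pos hG
  have hν : nuConst ε = veeNorm G := by rw [nuConst, hε, Real.sqrt_sq hg.le]
  have hμ : muConst ε G = Real.sqrt 2 * veeNorm G := by
    rw [muConst, hε, ← two_mul, Real.sqrt_mul zero_le_two, Real.sqrt_sq hg.le]
  have h2 : Real.sqrt 2 * Real.sqrt 2 = 2 := Real.mul_self_sqrt zero_le_two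
  have hs1 : Real.sqrt 2 ≤ 283 / 200 := Real.sqrt_le_iff.2 ⟨by norm_num, by norm_num⟩
  have hs2 : 707 / 500 ≤ Real.sqrt 2 := Real.le_sqrt_of_sq_le (by norm_num)
  -- Here `ν = ‖G‖_∨` and `μ = √2 ‖G‖_∨`, so the extreme ratios are `ν/α = (1 + 1/√2)/2 ≈ 0.854` and
  -- `μ/α = (1 + √2)/2 ≈ 1.207`.
  have hα' : α = 2 * (2 - Real.sqrt 2) * veeNorm G := by
    rw [hα, hν, hμ]
    have : 0 < Real.sqrt 2 := by linarith
    field_simp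
    nlinarith
  have hw := fun i j => weight_mem (hε ▸ sq_nonneg _ : 0 ≤ ε) G i j
  rw [hν, hμ] at hw
  rw [hα']
  refine ⟨mul_pos (by linarith) hg, fun i j => ⟨le_trans ?_ (hw i j).1, (hw i j).2.trans ?_⟩⟩
  · rw [← mul_assoc]
    exact mul_le_of_le_one_left hg.le (by linarith)
  · rw [← mul_assoc]
    exact mul_le_mul_of_nonneg_right (by linarith) hg.le

/-- The preconditioned step `a = α D` is characterised by `⟨w ∘ a, Y⟩ = ⟨G, Y⟩` on the tangent
space, with entrywise weights `w` close to `1`. -/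
theorem IsWeightedProj.exists_weights {G D : Matrix (Fin n₁) (Fin n₂) ℝ} (hG : G ≠ 0) {ε α : ℝ}
    (hε : ε = veeNorm G ^ 2) (hα : α = 2 / ((muConst ε G)⁻¹ + (nuConst ε)⁻¹))
    {T : Submodule ℝ (Matrix (Fin n₁) (Fin n₂) ℝ)}
    (hD : IsWeightedProj ε G T (weighting ε G (-(1 / 4)) G) D) :
    ∃ w : Matrix (Fin n₁) (Fin n₂) ℝ, (∀ i j, 17 / 20 ≤ w i j ∧ w i j ≤ 121 / 100) ∧
      ∀ Y ∈ T, ∑ i, ∑ j, w i j * (α • D) i j * Y i j = frob G Y := by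
  obtain ⟨hα0, hw⟩ := weight_div_stepSize_mem hG hε hα
  have hε0 : 0 < ε := hε ▸ pow_pos (veeNorm_pos hG) 2
  refine ⟨fun i j => leftPrecond ε G i i ^ (1 / 4 : ℝ) * rightPrecond ε G j j ^ (1 / 4 : ℝ) / α,
    fun i j => ⟨(le_div_iff₀ hα0).2 (hw i j).1, (div_le_iff₀ hα0).2 (hw i j).2⟩,
    fun Y hY => ?_⟩
  have h := hD.2 Y hY
  rw [weightedInner, ← frob, frob_eq_sum] at h
  rw [frob_eq_sum, eq_comm, ← sub_eq_zero, ← h]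
  simp only [← Finset.sum_sub_distrib]
  refine Finset.sum_congr rfl fun i _ => Finset.sum_congr rfl fun j _ => ?_
  have hl := hε0.trans_le (leftPrecond_apply_mem ε G i).1
  have hr := hε0.trans_le (rightPrecond_apply_mem ε G j).1
  have hlp : 0 < leftPrecond ε G i i ^ (1 / 4 : ℝ) := Real.rpow_pos_of_pos hl _
  have hrp : 0 < rightPrecond ε G j j ^ (1 / 4 : ℝ) := Real.rpow_pos_of_pos hr _
  rw [weighting_apply, Matrix.sub_apply, weighting_apply, Real.rpow_neg hl.le,
    Real.rpow_neg hr.le, Matrix.smul_apply, smul_eq_mul]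
  field_simp

/-- One preconditioned tangent step contracts the error. -/
theorem norm_sub_step_le {T : Submodule ℝ (Matrix (Fin n₁) (Fin n₂) ℝ)}
    {e p a G w : Matrix (Fin n₁) (Fin n₂) ℝ} {δ : ℝ} (hδ : δ ≤ 1 / 50) (hp : p ∈ T) (ha : a ∈ T)
    (hep : ‖e - p‖ ≤ ‖e‖ / 50) (hw : ∀ i j, 17 / 20 ≤ w i j ∧ w i j ≤ 121 / 100)
    (hG : ∀ Y ∈ T, ∑ i, ∑ j, w i j * a i j * Y i j = frob G Y)
    (hGe : ∀ Y ∈ T, |frob G Y - frob e Y| ≤ δ * (‖e‖ * ‖Y‖)) :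
    ‖e - a‖ ≤ 8 / 25 * ‖e‖ := by
  set f := p - a with hf
  have hfT : f ∈ T := sub_mem hp ha
  have h1 : 17 / 20 * ‖f‖ ^ 2 ≤ ∑ i, ∑ j, w i j * f i j * f i j := by
    rw [← frob_self, frob_eq_sum, Finset.mul_sum]
    simp only [Finset.mul_sum]
    refine Finset.sum_le_sum fun i _ => Finset.sum_le_sum fun j _ => ?_
    rw [mul_assoc (w i j)]
    exact mul_le_mul_of_nonneg_right (hw i j).1 (mul_self_nonneg _)
  set q : Matrix (Fin n₁) (Fin n₂) ℝ := Matrix.of fun i j => (w i j - 1) * p i j with hq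
  have hqn : ‖q‖ ≤ 21 / 100 * ‖p‖ := by
    refine le_of_sq_le_sq ?_ (by positivity)
    rw [mul_pow, ← frob_self, ← frob_self, frob_eq_sum, frob_eq_sum, Finset.mul_sum]
    simp only [Finset.mul_sum]
    refine Finset.sum_le_sum fun i _ => Finset.sum_le_sum fun j _ => ?_
    obtain ⟨hw1, hw2⟩ := hw i j
    have : (w i j - 1) ^ 2 ≤ (21 / 100) ^ 2 := by nlinarith
    have := mul_le_mul_of_nonneg_right this (mul_self_nonneg (p i j))
    simp only [hq, Matrix.of_apply]
    linarith
  -- The normal equation, tested with `f` itself, removes `a`. What remains is the weight defect `q`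
  -- and `⟨p - G, f⟩`, which is small because both `p` and `G` are close to `e` on `T`.
  have h2 : ∑ i, ∑ j, w i j * f i j * f i j = frob q f + frob p f - frob G f := by
    rw [← hG f hfT, frob_eq_sum, frob_eq_sum, ← Finset.sum_add_distrib, ← Finset.sum_sub_distrib]
    refine Finset.sum_congr rfl fun i _ => ?_
    rw [← Finset.sum_add_distrib, ← Finset.sum_sub_distrib]
    refine Finset.sum_congr rfl fun j _ => ?_
    simp only [hq, hf, Matrix.of_apply, Matrix.sub_apply]
    ring
  have h3 := (abs_le.1 (abs_frob_le q f)).2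
  have h4 := (abs_le.1 (abs_frob_le (e - p) f)).1
  have h5 := (abs_le.1 (hGe f hfT)).1
  rw [frob_sub_left] at h4
  have hp' : ‖p‖ ≤ 51 / 50 * ‖e‖ := by
    have := norm_sub_le e (e - p)
    rw [sub_sub_cancel] at this
    linarith
  have hf0 := norm_nonneg f
  have he0 := norm_nonneg e
  have h6 : ‖q‖ * ‖f‖ ≤ 21 / 100 * (51 / 50 * ‖e‖) * ‖f‖ :=
    mul_le_mul_of_nonneg_right (by linarith) hf0
  have h7 : ‖e - p‖ * ‖f‖ ≤ ‖e‖ / 50 * ‖f‖ := mul_le_mul_of_nonneg_right hep hf0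
  have h8 : δ * (‖e‖ * ‖f‖) ≤ 1 / 50 * (‖e‖ * ‖f‖) :=
    mul_le_mul_of_nonneg_right hδ (mul_nonneg he0 hf0)
  have h9 : ‖f‖ ≤ 3 / 10 * ‖e‖ := by
    rcases hf0.eq_or_lt with h0 | h0
    · rw [← h0]
      positivity
    · refine le_of_mul_le_mul_right ?_ h0
      nlinarith [mul_nonneg he0 hf0]
  have h10 := norm_add_le (e - p) f
  rw [hf, sub_add_sub_cancel] at h10
  rw [hf] at h9
  linarith

end Preconditioning

/-! ### One PRGD step inside the ball. -/

section Iteration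

variable {n₁ n₂ m r : ℕ} {A : Fin m → Matrix (Fin n₁) (Fin n₂) ℝ} {δ : ℝ}

/-- The gradient vanishes only at the solution. -/
theorem eq_of_gradient_eq_zero (hA : SatisfiesRIP A (3 * r) δ)
    {X Z : Matrix (Fin n₁) (Fin n₂) ℝ} (hX : X.rank ≤ r) (hZ : Z.rank ≤ r)
    (hG : gradient A (sensing A X) Z = 0) : Z = X := by
  have h1 : ‖sensing A (Z - X)‖ ^ 2 = 0 := by
    rw [← real_inner_self_eq_norm_sq, ← frob_sensingAdjoint, ← gradient_sensing, hG]
    simp [frob]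
  have hrank : (Z - X).rank ≤ 3 * r := (rank_sub_le Z X).trans (by omega)
  have h2 := (hA.2.2 _ hrank).1
  rw [h1] at h2
  have h3 : ‖Z - X‖ ^ 2 ≤ 0 := by nlinarith [hA.2.1, sq_nonneg ‖Z - X‖]
  have h4 : ‖Z - X‖ = 0 := pow_eq_zero_iff two_ne_zero |>.1 (le_antisymm h3 (sq_nonneg _))
  exact sub_eq_zero.1 (norm_eq_zero.1 h4)

theorem IsPRGDStep.rank_le {y : EuclideanSpace ℝ (Fin m)} {ε α : ℝ}
    {Z Z' : Matrix (Fin n₁) (Fin n₂) ℝ} (h : IsPRGDStep A y r ε α Z Z') (hZ : Z.rank ≤ r) :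
    Z'.rank ≤ r := by
  by_cases hG : gradient A y Z = 0
  · rwa [h.1 hG]
  · obtain ⟨D, -, hD⟩ := h.2 hG
    exact hD.rank_le

/-- `X` competes in the best approximation defining `Z'`, so `Z'` is no farther from the untruncated
step than `X` is. The triangle inequality then doubles the factor `8/25`. -/
theorem IsPRGDStep.norm_sub_le (hA : SatisfiesRIP A (3 * r) δ) (hδ : δ ≤ 1 / 50)
    {X Z Z' : Matrix (Fin n₁) (Fin n₂) ℝ} (hX : X.rank ≤ r) (hZ : Z.rank ≤ r) {ε α : ℝ}
    (hε : ε = veeNorm (gradient A (sensing A X) Z) ^ 2)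
    (hα : α = 2 / ((muConst ε (gradient A (sensing A X) Z))⁻¹ + (nuConst ε)⁻¹))
    (h : IsPRGDStep A (sensing A X) r ε α Z Z')
    (hclose : ‖Z - X‖ ≤ (Matrix.toEuclideanLin X).singularValues (X.rank - 1) / 50) :
    ‖Z' - X‖ ≤ 16 / 25 * ‖Z - X‖ := by
  by_cases hG : gradient A (sensing A X) Z = 0
  · rw [h.1 hG, eq_of_gradient_eq_zero hA hX hZ hG]
    simp
  obtain ⟨D, hD, hZ'⟩ := h.2 hG
  obtain ⟨p, hp, hep⟩ := exists_tangent_approx hclose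
  obtain ⟨w, hw, hwG⟩ := hD.exists_weights hG hε hα
  have hGe : ∀ Y ∈ tangentSpace Z, |frob (gradient A (sensing A X) Z) Y - frob (Z - X) Y|
      ≤ δ * (‖Z - X‖ * ‖Y‖) := by
    intro Y hY
    rw [gradient_sensing, frob_sensingAdjoint]
    exact hA.abs_inner_sub_frob_le (rank_tangent_combination_le hX hZ hY)
  have h1 := norm_sub_step_le hδ hp (Submodule.smul_mem _ α hD.1) hep hw hwG hGe
  have h2 := hZ'.norm_sub_le hX
  have h3 := _root_.norm_sub_le (Z - α • D - X) (Z - α • D - Z')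
  rw [sub_sub_sub_cancel_left] at h3
  rw [sub_right_comm] at h1
  linarith

end Iteration

end PRGD

theorem mainTheorem1 {n₁ n₂ m r : ℕ} (A : Fin m → Matrix (Fin n₁) (Fin n₂) ℝ) (δ : ℝ)
    (hA : PRGD.SatisfiesRIP A (3 * r) δ)
    (X : Matrix (Fin n₁) (Fin n₂) ℝ) (hX : X.rank = r)
    (hδ : δ ≤ 1 / (50 + 100 * Real.sqrt (r : ℝ) * PRGD.condNumber X))
    (y : EuclideanSpace ℝ (Fin m)) (hy : y = PRGD.sensing A X)
    (ε α : ℕ → ℝ) (Xs : ℕ → Matrix (Fin n₁) (Fin n₂) ℝ)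
    (hε : ∀ t, ε t = PRGD.veeNorm (PRGD.gradient A y (Xs t)) ^ 2)
    (hα : ∀ t, α t = 2 /
      ((PRGD.muConst (ε t) (PRGD.gradient A y (Xs t)))⁻¹ + (PRGD.nuConst (ε t))⁻¹))
    (hXs : PRGD.IsPRGDSequence A y r ε α Xs) :
    ∃ μ : ℝ, 0 < μ ∧ μ ≤ 0.995 ∧ ∀ t, ‖Xs (t + 1) - X‖ ≤ μ * ‖Xs t - X‖ := by
  subst hy
  have hδ' := PRGD.delta_le_of_condNumber hδ
  have hrank : ∀ t, (Xs t).rank ≤ r := by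
    intro t
    induction t with
    | zero => exact hXs.1.rank_le
    | succ t ih => exact (hXs.2 t).rank_le ih
  have step : ∀ t, ‖Xs t - X‖ ≤ (Matrix.toEuclideanLin X).singularValues (X.rank - 1) / 50 →
      ‖Xs (t + 1) - X‖ ≤ 16 / 25 * ‖Xs t - X‖ := fun t =>
    (hXs.2 t).norm_sub_le hA hδ' hX.le (hrank t) (hε t) (hα t)
  -- The contraction holds only inside the ball, and keeps the next iterate there because `16/25 <
  -- 1`.
  have hclose : ∀ t, ‖Xs t - X‖
      ≤ (Matrix.toEuclideanLin X).singularValues (X.rank - 1) / 50 := by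
    intro t
    induction t with
    | zero => exact PRGD.norm_initial_sub_le_singularValue hA hX hδ hXs.1
    | succ t ih => linarith [step t ih, norm_nonneg (Xs t - X)]
  exact ⟨16 / 25, by norm_num, by norm_num, fun t => step t (hclose t)⟩
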